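/- Let $1<p\le\infty$, let $X$ be a quasi-reflexive Banach space (i.e. $\dim X^{**}/X<\infty$), and let $A:X\to Y$ be a bounded linear operator into a Banach space $Y$, over the scalars $\mathbb K\in\{\mathbb R,\mathbb C\}$. Let $D_X$ be the set of weakly open subsets of $X$ containing $0$, directed by reverse inclusion. A weakly null tree of height $n$ in $B_X$ is a family $(x_t)\subset B_X$ indexed by the sequences $t$ in $D_X$ of length $1,\dots,n$, such that for every sequence $t$ in $D_X$ of length $<n$ (including the empty one) the net $(x_{t\smallfrown(u)})_{u\in D_X}$ is weakly null. For $a\in c_{00}$ put $$\Big\|\sum_i a_ie_i\Big\|_{0,A}=\sup\Big\{\inf_{t\in D_X^n}\Big\|A\sum_{i=1}^n a_ix_{(t_1,\dots,t_i)}\Big\| : n\in\mathbb N,\ (x_t)\text{ a weakly null tree of height } n \text{ in } B_X\Big\}.$$ With $1/p+1/q=1$, let $$\alpha_{0,p}(A)=\sup_n\sup\Big\{\Big\|\sum_{i=1}^n a_ie_i\Big\|_{0,A}:\ a\in B_{\ell_p^n}\Big\},\qquad N_{0,p}(A)=\sup_n n^{1/q}\Big\|\frac1n\sum_{i=1}^n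 e_i\Big\|_{0,A},$$ and write $A\in\mathfrak A_{0,p}$ if $\alpha_{0,p}(A)<\infty$, and $A\in\mathfrak N_{0,p}$ if $N_{0,p}(A)<\infty$. For positive $w_1,\dots,w_k$ let $G_k^w$ be the set $\mathbb N^k$ with the metric $d(\bar m,\bar n)=\sum_{i:\,m_i\ne n_i}w_i$, and let $G_k$ be $G_k^w$ for $w=(1,\dots,1)$. $\mathrm{Lip}(f)$ is the least Lipschitz constant of $f$, and $k^{1/\infty}=1$. (i) For any $k\in\mathbb N$, any positive $w_1,\dots,w_k$, any $\vartheta>2\|\sum_{i=1}^k w_ie_i\|_{0,A}$ and any Lipschitz map $f:G_k^w\to X$, there is an infinite $M\subset\mathbb N$ such that for all $m_1<n_1<\dots<m_k<n_k$ in $M$, $$\|Af(m_1,\dots,m_k)-Af(n_1,\dots,n_k)\|\le \mathrm{Lip}(f)\,\vartheta .$$ (ii) If $A\in\mathfrak A_{0,p}$ and $\alpha_{0,p}(A)>0$, then for any $\vartheta>2$, any $k\in\mathbb N$, any positive $w_1,\dots,w_k$ and any Lipschitz map $f:G_k^w\to X$, there is an infinite $M\subset\mathbb N$ such that for all $m_1<n_1<\dots<m_k<n_k$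 in $M$, $$\|Af(m_1,\dots,m_k)-Af(n_1,\dots,n_k)\|\le \vartheta\,\mathrm{Lip}(f)\,\alpha_{0,p}(A)\,\|w\|_{\ell_p^k}.$$ (iii) If $A\in\mathfrak N_{0,p}$ and $N_{0,p}(A)>0$, then for any $\vartheta>2$, any $k\in\mathbb N$ and any Lipschitz map $f:G_k\to X$, there is an infinite $M\subset\mathbb N$ such that for all $m_1<n_1<\dots<m_k<n_k$ in $M$, $$\|Af(m_1,\dots,m_k)-Af(n_1,\dots,n_k)\|\le \vartheta\,\mathrm{Lip}(f)\,N_{0,p}(A)\,k^{1/p}.$$ -/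

import Mathlib

open Filter Topology
open scoped ENNReal

noncomputable section

namespace AsymptoticSmoothness

section Spaces

variable (𝕜 : Type*) [RCLike 𝕜] (X : Type*) [NormedAddCommGroup X] [NormedSpace 𝕜 X]

set_option maxSynthPendingDepth 3 in
/-- `X` is quasi-reflexive: the quotient of the bidual `X**` by the canonical image of `X` is finite
dimensional (reflexive spaces are included). -/
def QuasiReflexive : Prop :=
  FiniteDimensional 𝕜 (StrongDual 𝕜 (StrongDual 𝕜 X) ⧸
    (NormedSpace.inclusionInDoubleDual 𝕜 X).range)

/-- The directed set `D_X` of weakly open subsets of `X` containing `0`, ordered by reverse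
inclusion. -/
abbrev WeakNhd : Type _ := (TopologicalSpace.OpenNhdsOf (0 : WeakSpace 𝕜 X))ᵒᵈ

variable {X}

/-- A weakly null collection `(x_t)` in the closed unit ball of `X`, indexed by the sequences `t` in
`D_X` of length `1, …, n`. (The tree `Γ_{0,n}` is the single chain
`(n-1), (n-1,n-2), …, (n-1,…,0)`, so the members of `Γ_{0,n}.D_X` are the sequences in `D_X` of
length between `1` and `n`, and the `i`-th level consists of those of length `i`.)
Values of `x` at other lists are irrelevant. -/
def IsWeaklyNullTree (n : ℕ) (x : List (WeakNhd 𝕜 X) → X) : Prop :=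
  (∀ t, t ≠ [] → t.length ≤ n → ‖x t‖ ≤ 1) ∧
  ∀ t : List (WeakNhd 𝕜 X), t.length < n →
    Tendsto (fun u : WeakNhd 𝕜 X => toWeakSpace 𝕜 X (x (t ++ [u]))) atTop (𝓝 0)

end Spaces

section Operators

variable {𝕜 : Type*} [RCLike 𝕜]
  {X : Type*} [NormedAddCommGroup X] [NormedSpace 𝕜 X]
  {Y : Type*} [NormedAddCommGroup Y] [NormedSpace 𝕜 Y]

/-- The vector `∑ a_i e_i` of `c₀₀` (coordinates are indexed from `0`). -/
def toC00 {n : ℕ} (a : Fin n → 𝕜) : ℕ →₀ 𝕜 :=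
  ∑ i : Fin n, Finsupp.single (i : ℕ) (a i)

/-- The seminorm `‖∑ a_i e_i‖_{0,A}` on `c₀₀`: the supremum over `n` and over weakly null trees
`(x_t)` of height `n` in the unit ball of `X` of the infimum over the maximal branches `t` of
`‖A ∑_{i ≤ n} a_i x_{t|i}‖`. -/
def asymNorm (A : X →L[𝕜] Y) (a : ℕ →₀ 𝕜) : ℝ≥0∞ :=
  ⨆ (n : ℕ) (x : List (WeakNhd 𝕜 X) → X) (_ : IsWeaklyNullTree 𝕜 n x),
    ⨅ (t : List (WeakNhd 𝕜 X)) (_ : t.length = n),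
      ‖A (∑ i ∈ Finset.range n, a i • x (t.take (i + 1)))‖ₑ

/-- `α_{0,p}(A)`: the supremum over `n` and `a` in the closed unit ball of `ℓ_p^n` of
`‖∑ a_i e_i‖_{0,A}`. -/
def alpha (p : ℝ≥0∞) (A : X →L[𝕜] Y) : ℝ≥0∞ :=
  ⨆ (n : ℕ) (a : PiLp p (fun _ : Fin n => 𝕜)) (_ : ‖a‖ ≤ 1), asymNorm A (toC00 (fun i => a i))

/-- `θ_{0,n}(A) = ‖n⁻¹ ∑_{i ≤ n} e_i‖_{0,A}`. -/
def theta (n : ℕ) (A : X →L[𝕜] Y) : ℝ≥0∞ :=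
  asymNorm A (toC00 (fun _ : Fin n => (n : 𝕜)⁻¹))

/-- `N_{0,p}(A) = sup_n n^{1/q} θ_{0,n}(A)`, where `1/q = 1 - 1/p` (and `1/∞ = 0`). -/
def bigN (p : ℝ≥0∞) (A : X →L[𝕜] Y) : ℝ≥0∞ :=
  ⨆ (n : ℕ) (_ : 1 ≤ n), (n : ℝ≥0∞) ^ (1 - (p⁻¹).toReal) * theta n A

/-- The class `𝔄_{0,p}`. -/
def ClassA (p : ℝ≥0∞) (A : X →L[𝕜] Y) : Prop := alpha p A < ∞

/-- The class `𝔑_{0,p}`. -/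
def ClassN (p : ℝ≥0∞) (A : X →L[𝕜] Y) : Prop := bigN p A < ∞

end Operators

section Graphs

variable {k : ℕ} {X : Type*} [NormedAddCommGroup X]

/-- The metric of `G_k^w`, whose points are all sequences of length `k` in `ℕ`:
`d(m, n) = ∑_{i : m_i ≠ n_i} w_i`. -/
def graphDist (w : Fin k → ℝ) (m n : Fin k → ℕ) : ℝ :=
  ∑ i with m i ≠ n i, w i

/-- `C ≥ 0` is a Lipschitz constant of `f : G_k^w → X`. -/
def IsLipConst (w : Fin k → ℝ) (f : (Fin k → ℕ) → X) (C : ℝ) : Prop :=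
  0 ≤ C ∧ ∀ m n, ‖f m - f n‖ ≤ C * graphDist w m n

/-- `f : G_k^w → X` is Lipschitz. -/
def IsLipschitz (w : Fin k → ℝ) (f : (Fin k → ℕ) → X) : Prop := ∃ C, IsLipConst w f C

/-- `Lip(f)`, the least Lipschitz constant of `f : G_k^w → X`. -/
def lip (w : Fin k → ℝ) (f : (Fin k → ℕ) → X) : ℝ := sInf {C | IsLipConst w f C}

/-- `m_1 < n_1 < m_2 < n_2 < ⋯ < m_k < n_k`. -/
def Interlaced (m n : Fin k → ℕ) : Prop :=
  (∀ i, m i < n i) ∧ ∀ i j, i < j → n i < m j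

end Graphs

end AsymptoticSmoothness

end

/-!
Fix a nonprincipal ultrafilter on `ℕ` and regard `f`, composed with the embedding `X → X**`, as a
function of lists of integers. Its iterated weak* limits over the last entries form a martingale in
`X**` whose `i`-th increment has norm at most `Lip(f) w_i`. Running it along the `m`'s and along
the `n`'s and subtracting gives differences whose increments have norm at most `2 Lip(f) w_i` and
tend weak* to `0`. As `X**/X` is finite dimensional, both copies have the same limit modulo `X`, so
the differences are eventually close to `X`, and by Goldstine's theorem their increments are close
to vectors of `X` lying in any prescribed weak neighbourhood of `0`. These vectors make up a weakly
null tree whose branches add up to almost `f(m) - f(n)`, so `‖Af(m) - Af(n)‖` is bounded as required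
for almost all `m₁, n₁, …, m_k, n_k` in the iterated sense. A Ramsey argument turns this into a
statement about all interlaced pairs in an infinite set.
-/

noncomputable section

namespace AsymptoticSmoothness

section UltrafilterCombinatorics

variable {α β : Type*}

/-- The tensor (Fubini) product of two ultrafilters: `s` is large if for `U`-many `a`, the pair
`(a, b)` belongs to `s` for `V`-many `b`. -/
def tensor (U : Ultrafilter α) (V : Ultrafilter β) : Ultrafilter (α × β) :=
  U.bind fun a => V.map (Prod.mk a)

/-- The `n`-fold tensor power of an ultrafilter. It lives on lists, which have length `n` almost
surely; the first entry is chosen first. -/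
def tensorPower (U : Ultrafilter α) : ℕ → Ultrafilter (List α)
  | 0 => pure []
  | n + 1 => U.bind fun x => (tensorPower U n).map (x :: ·)

theorem eventually_tensor {U : Ultrafilter α} {V : Ultrafilter β} {P : α × β → Prop} :
    (∀ᶠ x in tensor U V, P x) ↔ ∀ᶠ a in U, ∀ᶠ b in V, P (a, b) :=
  Iff.rfl

theorem eventually_tensorPower_zero {U : Ultrafilter α} {P : List α → Prop} :
    (∀ᶠ σ in tensorPower U 0, P σ) ↔ P [] :=
  Iff.rfl

theorem eventually_tensorPower_succ {U : Ultrafilter α} {n : ℕ} {P : List α → Prop} :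
    (∀ᶠ σ in tensorPower U (n + 1), P σ) ↔ ∀ᶠ x in U, ∀ᶠ σ in tensorPower U n, P (x :: σ) :=
  Iff.rfl

theorem map_fst_tensor (U : Ultrafilter α) (V : Ultrafilter β) :
    (tensor U V).map Prod.fst = U :=
  Ultrafilter.ext fun s =>
    (eventually_tensor (P := fun x => x.1 ∈ s)).trans (by simp only [eventually_const]; rfl)

theorem map_snd_tensor (U : Ultrafilter α) (V : Ultrafilter β) :
    (tensor U V).map Prod.snd = V :=
  Ultrafilter.ext fun s =>
    (eventually_tensor (P := fun x => x.2 ∈ s)).trans (by simp only [eventually_const]; rfl)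

theorem map_tensorPower (f : α → β) (U : Ultrafilter α) (n : ℕ) :
    (tensorPower U n).map (List.map f) = tensorPower (U.map f) n := by
  induction n with
  | zero => rfl
  | succ n ih =>
    refine Ultrafilter.ext fun s => ?_
    change (∀ᶠ x in (U : Filter α), ∀ᶠ τ in ((tensorPower U n).map (List.map f) : Filter (List β)),
      f x :: τ ∈ s) ↔ _
    rw [ih]
    rfl

/-- The list `[m₁, n₁, …, m_k, n_k]` obtained from `[(m₁, n₁), …, (m_k, n_k)]`. -/
def interleave (τ : List (α × α)) : List α :=
  τ.flatMap fun x => [x.1, x.2]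

theorem eventually_tensorPower_tensor {U : Ultrafilter α} {n : ℕ} {P : List α → Prop} :
    (∀ᶠ τ in tensorPower (tensor U U) n, P (interleave τ)) ↔
      ∀ᶠ σ in tensorPower U (2 * n), P σ := by
  induction n generalizing P with
  | zero => rfl
  | succ n ih =>
    simp only [eventually_tensorPower_succ, eventually_tensor, Nat.mul_succ, interleave,
      List.flatMap_cons, List.cons_append, List.nil_append, ← ih]

theorem interleave_injective : Function.Injective (interleave : List (α × α) → List α) := by
  intro τ
  induction τ with
  | nil => rintro (_ | ⟨y, τ'⟩) h <;> simp_all [interleave]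
  | cons x τ ih =>
    rintro (_ | ⟨y, τ'⟩) h
    · simp [interleave] at h
    · simp only [interleave, List.flatMap_cons, List.cons_append, List.nil_append,
        List.cons.injEq] at h
      rw [Prod.ext h.1 h.2.1, ih h.2.2]

theorem eventually_length_eq (U : Ultrafilter α) (n : ℕ) :
    ∀ᶠ σ : List α in tensorPower U n, σ.length = n := by
  induction n with
  | zero => exact eventually_tensorPower_zero.2 rfl
  | succ n ih =>
    exact eventually_tensorPower_succ.2 (Eventually.of_forall fun x => ih.mono fun σ hσ => by
      rw [List.length_cons, hσ])

theorem exists_tree_of_eventually_tensorPower {U : Ultrafilter α} {k : ℕ} {R : List α → Prop}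
    (hR : ∀ n ≤ k, ∀ᶠ σ in tensorPower U n, R σ) :
    ∃ T : Set (List α), [] ∈ T ∧ (∀ σ ∈ T, ∀ᶠ x in U, σ ++ [x] ∈ T) ∧
      ∀ σ ∈ T, σ.length ≤ k → R σ := by
  refine ⟨{σ | ∀ n, σ.length + n ≤ k → ∀ᶠ τ in tensorPower U n, R (σ ++ τ)}, ?_, ?_, ?_⟩
  · exact fun n hn => hR n (by simpa using hn)
  · intro σ hσ
    have hext : ∀ n ∈ Set.Iic k, ∀ᶠ x in U, (σ ++ [x]).length + n ≤ k →
        ∀ᶠ τ in tensorPower U n, R (σ ++ [x] ++ τ) := by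
      intro n _
      by_cases hn : σ.length + (n + 1) ≤ k
      · filter_upwards [eventually_tensorPower_succ.1 (hσ (n + 1) hn)] with x hx _
        simpa using hx
      · refine Eventually.of_forall fun x hx => absurd hx ?_
        rw [List.length_append, List.length_singleton]
        omega
    filter_upwards [(Set.finite_Iic k).eventually_all.2 hext] with x hx n hn
    exact hx n (Set.mem_Iic.2 (by omega)) hn
  · intro σ hσ hlen
    simpa using eventually_tensorPower_zero.1 (hσ 0 (by simpa using hlen))

theorem exists_infinite_forall_finset_of_eventually_insert [DecidableEq α] {l : Filter α} [l.NeBot]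
    (hl : l ≤ cofinite) {Q : Finset α → Prop} (h0 : Q ∅)
    (hQ : ∀ S, Q S → ∀ᶠ x in l, Q (insert x S)) :
    ∃ M : Set α, M.Infinite ∧ ∀ S : Finset α, ↑S ⊆ M → Q S := by
  let F : Set (Set α) := {M | ∀ S : Finset α, ↑S ⊆ M → Q S}
  have hF : Order.IsOfFiniteCharacter F := fun M =>
    ⟨fun hM N hN _ S hS => hM S (hS.trans hN), fun hM S hS => hM S hS S.finite_toSet S subset_rfl⟩
  have hempty : ∅ ∈ F := fun S hS => by rwa [Finset.coe_eq_empty.1 (Set.subset_empty_iff.1 hS)]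
  obtain ⟨M, -, hM⟩ := hF.exists_maximal hempty
  refine ⟨M, fun hfin => ?_, hM.prop⟩
  have hsub : ∀ᶠ x in l, ∀ S ∈ hfin.toFinset.powerset, Q (insert x S) :=
    (eventually_all_finset _).2 fun S hS => hQ S (hM.prop S (by simpa using hS))
  obtain ⟨x, hx, hxM⟩ := (hsub.and (hl hfin.compl_mem_cofinite)).exists
  refine hxM (hM.mem_of_prop_insert fun S hS => ?_)
  by_cases hxS : x ∈ S
  · rw [← Finset.insert_erase hxS]
    refine hx _ (Finset.mem_powerset.2 (Finset.coe_subset.1 ?_))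
    simpa only [Finset.coe_erase, hfin.coe_toFinset] using Set.sdiff_singleton_subset_iff.2 hS
  · exact hM.prop S ((Set.subset_insert_iff_of_notMem (by simpa using hxS)).1 hS)

theorem sort_insert_of_forall_lt [LinearOrder α] {S : Finset α} {x : α} (hx : ∀ y ∈ S, y < x) :
    (insert x S).sort = S.sort ++ [x] := by
  have hlt : (S.sort ++ [x]).Pairwise (· < ·) := by
    refine List.pairwise_append.2 ⟨S.sortedLT_sort.pairwise, List.pairwise_singleton _ _, ?_⟩
    simpa only [Finset.mem_sort, List.mem_singleton, forall_eq] using hx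
  rw [← (List.toFinset_sort (· ≤ ·) hlt.nodup).2 (hlt.imp le_of_lt)]
  simp [List.toFinset_append]

theorem exists_infinite_forall_pairwise_lt {U : Ultrafilter ℕ} (hU : (U : Filter ℕ) ≤ atTop) {L : ℕ}
    {P : List ℕ → Prop} (hP : ∀ᶠ σ in tensorPower U L, P σ) :
    ∃ M : Set ℕ, M.Infinite ∧
      ∀ σ : List ℕ, (∀ x ∈ σ, x ∈ M) → σ.length = L → σ.Pairwise (· < ·) → P σ := by
  have hlevel (n : ℕ) : ∀ᶠ σ : List ℕ in tensorPower U n, σ.length = L → P σ := by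
    by_cases hn : n = L
    · subst hn
      exact hP.mono fun _ hσ _ => hσ
    · exact (eventually_length_eq U n).mono fun σ hσ hσL => absurd (hσ.symm.trans hσL) hn
  obtain ⟨T, hT0, hT, hTP⟩ := exists_tree_of_eventually_tensorPower (k := L) fun n _ => hlevel n
  obtain ⟨M, hM, hMT⟩ := exists_infinite_forall_finset_of_eventually_insert
    (hU.trans Nat.cofinite_eq_atTop.ge) (Q := fun S : Finset ℕ => S.sort (· ≤ ·) ∈ T)
    (by rwa [Finset.sort_empty])
    fun S hS => by
      filter_upwards [hT _ hS, hU (eventually_gt_atTop (S.sup id))] with x hxT hx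
      rwa [sort_insert_of_forall_lt fun y hy => (Finset.le_sup (f := id) hy).trans_lt hx]
  refine ⟨M, hM, fun σ hσM hσL hσ => hTP σ ?_ hσL.le hσL⟩
  rw [← (List.toFinset_sort (· ≤ ·) hσ.nodup).2 (hσ.imp le_of_lt)]
  exact hMT _ (by simpa [Set.subset_def] using hσM)

theorem Interlaced.pairwise_interleave {k : ℕ} {m n : Fin k → ℕ} (h : Interlaced m n) :
    (interleave (List.ofFn fun i => (m i, n i))).Pairwise (· < ·) := by
  simp only [interleave, List.pairwise_flatMap, List.pairwise_ofFn, List.forall_mem_ofFn_iff,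
    List.pairwise_pair]
  refine ⟨h.1, fun i j hij => ?_⟩
  simp only [List.mem_cons, List.not_mem_nil, or_false, forall_eq_or_imp, forall_eq]
  have hmi := h.1 i
  have hni := h.2 i j hij
  have hmj := h.1 j
  omega

theorem exists_infinite_forall_interlaced {U : Ultrafilter ℕ} (hU : (U : Filter ℕ) ≤ atTop) {k : ℕ}
    {P : List (ℕ × ℕ) → Prop} (hP : ∀ᶠ τ in tensorPower (tensor U U) k, P τ) :
    ∃ M : Set ℕ, M.Infinite ∧ ∀ m n : Fin k → ℕ, (∀ i, m i ∈ M) → (∀ i, n i ∈ M) →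
      Interlaced m n → P (List.ofFn fun i => (m i, n i)) := by
  have hσ : ∀ᶠ σ in tensorPower U (2 * k), ∃ τ, interleave τ = σ ∧ P τ :=
    eventually_tensorPower_tensor.1 (hP.mono fun τ hτ => ⟨τ, rfl, hτ⟩)
  obtain ⟨M, hM, h⟩ := exists_infinite_forall_pairwise_lt hU hσ
  refine ⟨M, hM, fun m n hm hn hmn => ?_⟩
  have hmem : ∀ x ∈ interleave (List.ofFn fun i => (m i, n i)), x ∈ M := by
    simp only [interleave, List.mem_flatMap, List.mem_ofFn, List.mem_cons, List.not_mem_nil,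
      or_false]
    rintro x ⟨-, ⟨i, rfl⟩, rfl | rfl⟩
    exacts [hm i, hn i]
  have hlen : (interleave (List.ofFn fun i => (m i, n i))).length = 2 * k := by
    simp only [interleave, List.length_flatMap, List.map_ofFn]
    simp [Function.comp_def, mul_comm]
  obtain ⟨τ, hτ, hPτ⟩ := h _ hmem hlen hmn.pairwise_interleave
  rwa [← interleave_injective hτ]

end UltrafilterCombinatorics

section WeakStarLimits

variable {ι 𝕜 E : Type*} [RCLike 𝕜] [NormedAddCommGroup E] [NormedSpace 𝕜 E] {𝓥 : Ultrafilter ι}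
  {g : ι → StrongDual 𝕜 E} {R : ℝ}

/-- The weak* limit of a family of functionals along an ultrafilter. It exists whenever the family
is bounded (Banach–Alaoglu) and is a junk value otherwise. -/
def weakStarLim (𝓥 : Ultrafilter ι) (g : ι → StrongDual 𝕜 E) : StrongDual 𝕜 E :=
  WeakDual.toStrongDual (limUnder 𝓥 fun i => StrongDual.toWeakDual (g i))

theorem tendsto_weakStarLim (hg : ∀ i, ‖g i‖ ≤ R) (φ : E) :
    Tendsto (fun i => g i φ) 𝓥 (𝓝 (weakStarLim 𝓥 g φ)) := by
  have hball : ∀ᶠ i in (𝓥 : Filter ι), StrongDual.toWeakDual (g i) ∈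
      WeakDual.toStrongDual ⁻¹' Metric.closedBall (0 : StrongDual 𝕜 E) R :=
    Eventually.of_forall fun i => mem_closedBall_zero_iff.2 (hg i)
  obtain ⟨z, -, hz⟩ := (WeakDual.isCompact_closedBall (𝕜 := 𝕜) (0 : StrongDual 𝕜 E) R
    ).ultrafilter_le_nhds (𝓥.map fun i => StrongDual.toWeakDual (g i)) (le_principal_iff.2 hball)
  have hlim := tendsto_nhds_limUnder (f := (𝓥 : Filter ι))
    (g := fun i => StrongDual.toWeakDual (g i)) ⟨z, hz⟩
  exact ((WeakDual.eval_continuous φ).tendsto _).comp hlim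

theorem norm_le_of_tendsto_apply {l : Filter ι} [l.NeBot] {ψ : StrongDual 𝕜 E}
    (hg : ∀ i, ‖g i‖ ≤ R) (hψ : ∀ φ, Tendsto (fun i => g i φ) l (𝓝 (ψ φ))) : ‖ψ‖ ≤ R := by
  obtain ⟨i⟩ := l.nonempty_of_neBot
  exact ψ.opNorm_le_bound ((norm_nonneg _).trans (hg i)) fun φ =>
    le_of_tendsto (hψ φ).norm (Eventually.of_forall fun i => (g i).le_of_opNorm_le (hg i) φ)

/-- The limit of the values of `g` at extensions of the list `σ` by `n` entries, in the weak*
topology and along the `n`-fold tensor power of `U`: the analogue of a conditional expectation of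
`g` given its first entries `σ`. -/
def condLim {α : Type*} (U : Ultrafilter α) (g : List α → StrongDual 𝕜 E) (n : ℕ) (σ : List α) :
    StrongDual 𝕜 E :=
  weakStarLim (tensorPower U n) fun τ => g (σ ++ τ)

variable {α : Type*} {U : Ultrafilter α} {G : List α → StrongDual 𝕜 E}

theorem tendsto_condLim (hG : ∀ σ, ‖G σ‖ ≤ R) (n : ℕ) (σ : List α) (φ : E) :
    Tendsto (fun τ => G (σ ++ τ) φ) (tensorPower U n) (𝓝 (condLim U G n σ φ)) :=
  tendsto_weakStarLim (fun τ => hG (σ ++ τ)) φ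

theorem norm_condLim_le (hG : ∀ σ, ‖G σ‖ ≤ R) (n : ℕ) (σ : List α) : ‖condLim U G n σ‖ ≤ R :=
  norm_le_of_tendsto_apply (l := tensorPower U n) (fun τ => hG (σ ++ τ)) (tendsto_condLim hG n σ)

theorem condLim_zero (hG : ∀ σ, ‖G σ‖ ≤ R) (σ : List α) : condLim U G 0 σ = G σ := by
  ext φ
  have h := tendsto_condLim (U := U) hG 0 σ φ
  refine tendsto_nhds_unique h (tendsto_nhds_of_eventually_eq ?_)
  rw [eventually_tensorPower_zero, List.append_nil]

theorem tendsto_condLim_append_singleton (hG : ∀ σ, ‖G σ‖ ≤ R) (n : ℕ) (σ : List α) (φ : E) :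
    Tendsto (fun x => condLim U G n (σ ++ [x]) φ) U (𝓝 (condLim U G (n + 1) σ φ)) := by
  refine (closed_nhds_basis _).tendsto_right_iff.2 fun s ⟨hs, hsc⟩ => ?_
  filter_upwards [eventually_tensorPower_succ.1
    ((tendsto_condLim hG (n + 1) σ φ).eventually_mem hs)] with x hx
  refine hsc.mem_of_tendsto (tendsto_condLim hG n (σ ++ [x]) φ) (hx.mono fun τ hτ => ?_)
  rwa [List.append_assoc, List.singleton_append]

theorem norm_condLim_sub_condLim_le (hG : ∀ σ, ‖G σ‖ ≤ R) {D : ℝ} {n : ℕ} {σ σ' : List α}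
    (hD : ∀ τ, ‖G (σ ++ τ) - G (σ' ++ τ)‖ ≤ D) : ‖condLim U G n σ - condLim U G n σ'‖ ≤ D :=
  norm_le_of_tendsto_apply (l := tensorPower U n) hD fun φ =>
    (tendsto_condLim hG n σ φ).sub (tendsto_condLim hG n σ' φ)

theorem norm_condLim_append_singleton_sub_le (hG : ∀ σ, ‖G σ‖ ≤ R) {D : ℝ} {n : ℕ} {σ : List α}
    (hD : ∀ x y τ, ‖G (σ ++ x :: τ) - G (σ ++ y :: τ)‖ ≤ D) (x : α) :
    ‖condLim U G n (σ ++ [x]) - condLim U G (n + 1) σ‖ ≤ D := by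
  refine norm_le_of_tendsto_apply (l := U)
    (g := fun y => condLim U G n (σ ++ [x]) - condLim U G n (σ ++ [y])) (fun y => ?_) fun φ =>
    tendsto_const_nhds.sub (tendsto_condLim_append_singleton hG n σ φ)
  exact norm_condLim_sub_condLim_le hG fun τ => by
    simpa only [List.append_assoc, List.singleton_append] using hD x y τ

/-- The difference of the conditional limits of `G` along the first and along the second entries of
a list of pairs. -/
def pairDiff (U : Ultrafilter α) (G : List α → StrongDual 𝕜 E) (n : ℕ) (τ : List (α × α)) :
    StrongDual 𝕜 E :=
  condLim U G n (τ.map Prod.fst) - condLim U G n (τ.map Prod.snd)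

theorem pairDiff_nil (n : ℕ) : pairDiff U G n [] = 0 :=
  sub_self _

theorem pairDiff_zero (hG : ∀ σ, ‖G σ‖ ≤ R) (τ : List (α × α)) :
    pairDiff U G 0 τ = G (τ.map Prod.fst) - G (τ.map Prod.snd) := by
  rw [pairDiff, condLim_zero hG, condLim_zero hG]

theorem tendsto_pairDiff_append_singleton (hG : ∀ σ, ‖G σ‖ ≤ R) (n : ℕ) (τ : List (α × α))
    (φ : E) :
    Tendsto (fun x => pairDiff U G n (τ ++ [x]) φ) (tensor U U) (𝓝 (pairDiff U G (n + 1) τ φ)) := by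
  have hfst : Tendsto Prod.fst (tensor U U : Filter (α × α)) U :=
    (congrArg Ultrafilter.toFilter (map_fst_tensor U U)).le
  have hsnd : Tendsto Prod.snd (tensor U U : Filter (α × α)) U :=
    (congrArg Ultrafilter.toFilter (map_snd_tensor U U)).le
  simp only [pairDiff, List.map_append, List.map_cons, List.map_nil, sub_apply]
  exact ((tendsto_condLim_append_singleton hG n _ φ).comp hfst).sub
    ((tendsto_condLim_append_singleton hG n _ φ).comp hsnd)

theorem norm_pairDiff_append_singleton_sub_le (hG : ∀ σ, ‖G σ‖ ≤ R) {D : ℝ} {n : ℕ}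
    {τ : List (α × α)}
    (hD : ∀ σ : List α, σ.length = τ.length → ∀ x y ρ, ‖G (σ ++ x :: ρ) - G (σ ++ y :: ρ)‖ ≤ D)
    (x : α × α) :
    ‖pairDiff U G n (τ ++ [x]) - pairDiff U G (n + 1) τ‖ ≤ 2 * D := by
  have hfst := norm_condLim_append_singleton_sub_le (U := U) (n := n) hG
    (hD _ (τ.length_map Prod.fst)) x.1
  have hsnd := norm_condLim_append_singleton_sub_le (U := U) (n := n) hG
    (hD _ (τ.length_map Prod.snd)) x.2
  simp only [pairDiff, List.map_append, List.map_cons, List.map_nil]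
  rw [sub_sub_sub_comm, two_mul]
  exact (norm_sub_le _ _).trans (add_le_add hfst hsnd)

end WeakStarLimits

section Bidual

set_option maxSynthPendingDepth 3

variable {𝕜 : Type*} [RCLike 𝕜] {X : Type*} [NormedAddCommGroup X] [NormedSpace 𝕜 X]

open NormedSpace (inclusionInDoubleDual)

theorem norm_inclusionInDoubleDual (x : X) : ‖inclusionInDoubleDual 𝕜 X x‖ = ‖x‖ :=
  (NormedSpace.inclusionInDoubleDualLi (E := X) 𝕜).norm_map x

theorem norm_le_div_of_re_lt {ψ : StrongDual 𝕜 X} {r u : ℝ} (hr : 0 < r)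
    (hψ : ∀ x : X, ‖x‖ ≤ r → RCLike.re (ψ x) < u) : ‖ψ‖ ≤ u / r := by
  refine ContinuousLinearMap.opNorm_bound_of_ball_bound hr u ψ fun x hx => ?_
  obtain ⟨c, hc, hcx⟩ := RCLike.exists_norm_eq_mul_self (ψ x)
  have hlt := hψ (c • x) (by simpa [norm_smul, hc] using hx)
  rw [map_smul, smul_eq_mul, ← hcx, RCLike.ofReal_re] at hlt
  exact hlt.le

theorem apply_comp_pi {ι : Type*} [Finite ι] (e : StrongDual 𝕜 (StrongDual 𝕜 X))
    (φ : ι → StrongDual 𝕜 X) (g : StrongDual 𝕜 (ι → 𝕜)) :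
    e (g.comp (ContinuousLinearMap.pi φ)) = g fun i => e (φ i) := by
  classical
  cases nonempty_fintype ι
  have hg (v : ι → 𝕜) : g v = ∑ i, v i * g (Pi.single i 1) := by
    conv_lhs => rw [pi_eq_sum_univ' v]
    simp only [map_sum, map_smul, smul_eq_mul]
  have hcomp : g.comp (ContinuousLinearMap.pi φ) = ∑ i, g (Pi.single i 1) • φ i := by
    ext x
    simp [hg fun i => φ i x, mul_comm]
  rw [hcomp, hg]
  simp [mul_comm]

/-- **Goldstine's theorem** -/
theorem exists_norm_le_norm_apply_sub_lt (e : StrongDual 𝕜 (StrongDual 𝕜 X)) {r : ℝ}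
    (hr : 0 < r) (he : ‖e‖ ≤ r) {ι : Type*} [Finite ι] (φ : ι → StrongDual 𝕜 X) {δ : ℝ}
    (hδ : 0 < δ) : ∃ y : X, ‖y‖ ≤ r ∧ ∀ i, ‖φ i y - e (φ i)‖ < δ := by
  cases nonempty_fintype ι
  let T : X →L[𝕜] (ι → 𝕜) := ContinuousLinearMap.pi φ
  suffices hmem : (fun i => e (φ i)) ∈ closure (T '' Metric.closedBall 0 r) by
    obtain ⟨_, ⟨y, hy, rfl⟩, hdist⟩ := Metric.mem_closure_iff.1 hmem δ hδ
    refine ⟨y, mem_closedBall_zero_iff.1 hy, fun i => ?_⟩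
    rw [← dist_eq_norm, dist_comm]
    exact (dist_pi_lt_iff hδ).1 hdist i
  by_contra hnotMem
  have hconv : Convex ℝ (closure (T '' Metric.closedBall (0 : X) r)) :=
    letI : NormedSpace ℝ X := NormedSpace.restrictScalars ℝ 𝕜 X
    ((convex_closedBall (0 : X) r).is_linear_image
      (T.restrictScalars ℝ).toLinearMap.isLinear).closure
  obtain ⟨g, u, hgu, hu⟩ := RCLike.geometric_hahn_banach_closed_point (𝕜 := 𝕜) hconv
    isClosed_closure hnotMem
  have hnorm : ‖g.comp T‖ ≤ u / r := norm_le_div_of_re_lt hr fun x hx =>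
    hgu _ (subset_closure ⟨x, mem_closedBall_zero_iff.2 hx, rfl⟩)
  refine hu.not_ge ?_
  calc RCLike.re (g fun i => e (φ i)) = RCLike.re (e (g.comp T)) := by rw [apply_comp_pi]
    _ ≤ ‖e (g.comp T)‖ := RCLike.re_le_norm _
    _ ≤ r * (u / r) := (e.le_of_opNorm_le he _).trans (by gcongr)
    _ = u := mul_div_cancel₀ u hr.ne'

theorem exists_norm_inclusionInDoubleDual_sub_le {z : StrongDual 𝕜 (StrongDual 𝕜 X)} {y : X}
    {ε δ : ℝ} (hε : 0 < ε) (hδ : 0 < δ) (hy : ‖z - inclusionInDoubleDual 𝕜 X y‖ ≤ ε)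
    {F : Finset (StrongDual 𝕜 X)} (hF : ∀ φ ∈ F, ‖z φ‖ < δ) :
    ∃ x : X, ‖inclusionInDoubleDual 𝕜 X x - z‖ ≤ 2 * ε ∧ ∀ φ ∈ F, ‖φ x‖ < 2 * δ := by
  obtain ⟨y', hy', hy'F⟩ := exists_norm_le_norm_apply_sub_lt _ hε hy ((↑) : F → StrongDual 𝕜 X) hδ
  refine ⟨y + y', ?_, fun φ hφ => ?_⟩
  · have htri := norm_sub_le (inclusionInDoubleDual 𝕜 X y') (z - inclusionInDoubleDual 𝕜 X y)
    have hsum : inclusionInDoubleDual 𝕜 X (y + y') - z =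
        inclusionInDoubleDual 𝕜 X y' - (z - inclusionInDoubleDual 𝕜 X y) := by
      rw [map_add]; abel
    rw [← hsum, norm_inclusionInDoubleDual] at htri
    linarith
  · calc ‖φ (y + y')‖ = ‖(φ y' - (z - inclusionInDoubleDual 𝕜 X y) φ) + z φ‖ := by
          rw [sub_apply, NormedSpace.dual_def, map_add]; congr 1; ring
      _ ≤ ‖φ y' - (z - inclusionInDoubleDual 𝕜 X y) φ‖ + ‖z φ‖ := norm_add_le _ _
      _ < 2 * δ := by linarith [hy'F ⟨φ, hφ⟩, hF φ hφ]

theorem exists_finset_forall_norm_lt_mem (u : WeakNhd 𝕜 X) :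
    ∃ (F : Finset (StrongDual 𝕜 X)) (δ : ℝ), 0 < δ ∧
      ∀ x : X, (∀ φ ∈ F, ‖φ x‖ < δ) → toWeakSpace 𝕜 X x ∈ OrderDual.ofDual u := by
  have hu : ((OrderDual.ofDual u : TopologicalSpace.OpenNhdsOf (0 : WeakSpace 𝕜 X)) :
      Set (WeakSpace 𝕜 X)) ∈ 𝓝 (0 : WeakSpace 𝕜 X) :=
    (OrderDual.ofDual u).isOpen.mem_nhds (OrderDual.ofDual u).mem'
  obtain ⟨V, hV, hVu⟩ := ((topDualPairing 𝕜 X).flip.hasBasis_weakBilin.mem_iff).1 hu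
  obtain ⟨F, δ, hδ, rfl⟩ := (SeminormFamily.basisSets_iff _).1 hV
  refine ⟨F, δ, hδ, fun x hx => hVu ?_⟩
  refine (Seminorm.mem_ball_zero (p := F.sup (topDualPairing 𝕜 X).flip.toSeminormFamily)
    (y := x) (r := δ)).2 ?_
  exact Seminorm.finset_sup_apply_lt hδ hx

theorem eventually_exists_mem_weakNhd {β : Type*} {l : Filter β}
    {z : β → StrongDual 𝕜 (StrongDual 𝕜 X)} (hz : ∀ φ, Tendsto (fun x => z x φ) l (𝓝 0)) {ε : ℝ}
    (hε : 0 < ε) (hnear : ∀ᶠ x in l, ∃ y, ‖z x - inclusionInDoubleDual 𝕜 X y‖ ≤ ε)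
    (u : WeakNhd 𝕜 X) :
    ∀ᶠ x in l, ∃ y : X, toWeakSpace 𝕜 X y ∈ OrderDual.ofDual u ∧
      ‖inclusionInDoubleDual 𝕜 X y - z x‖ ≤ 2 * ε := by
  obtain ⟨F, δ, hδ, hu⟩ := exists_finset_forall_norm_lt_mem u
  have hF : ∀ᶠ x in l, ∀ φ ∈ F, ‖z x φ‖ < δ / 2 :=
    (eventually_all_finset F).2 fun φ _ =>
      (tendsto_zero_iff_norm_tendsto_zero.1 (hz φ)).eventually_lt_const (half_pos hδ)
  filter_upwards [hF, hnear] with x hxF ⟨y, hy⟩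
  obtain ⟨y', hy', hy'F⟩ := exists_norm_inclusionInDoubleDual_sub_le hε (half_pos hδ) hy hxF
  exact ⟨y', hu y' fun φ hφ => (hy'F φ hφ).trans_eq (mul_div_cancel₀ δ two_ne_zero), hy'⟩

theorem eventually_exists_norm_le_one_mem_weakNhd {β : Type*} {l : Filter β}
    {z : β → StrongDual 𝕜 (StrongDual 𝕜 X)} (hz : ∀ φ, Tendsto (fun x => z x φ) l (𝓝 0)) {ε : ℝ}
    (hε : 0 < ε) (hnear : ∀ᶠ x in l, ∃ y, ‖z x - inclusionInDoubleDual 𝕜 X y‖ ≤ ε) {a : ℝ}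
    (ha : ∀ x, ‖z x‖ + 2 * ε ≤ a) (u : WeakNhd 𝕜 X) :
    ∀ᶠ x in l, ∃ y : X, ‖y‖ ≤ 1 ∧ toWeakSpace 𝕜 X y ∈ OrderDual.ofDual u ∧
      ‖inclusionInDoubleDual 𝕜 X ((a : 𝕜) • y) - z x‖ ≤ 2 * ε := by
  let u' : WeakNhd 𝕜 X := OrderDual.toDual
    ⟨⟨{y | (a : 𝕜)⁻¹ • y ∈ OrderDual.ofDual u},
      (OrderDual.ofDual u).isOpen.preimage (continuous_const_smul _)⟩,
      (congrArg (· ∈ OrderDual.ofDual u) (smul_zero (a : 𝕜)⁻¹)).mpr (OrderDual.ofDual u).mem'⟩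
  filter_upwards [eventually_exists_mem_weakNhd hz hε hnear u'] with x ⟨y, hyu, hy⟩
  have ha0 : 0 < a := by linarith [ha x, norm_nonneg (z x)]
  have hy_le : ‖y‖ ≤ a := by
    have htri := norm_sub_norm_le (inclusionInDoubleDual 𝕜 X y) (z x)
    rw [norm_inclusionInDoubleDual] at htri
    linarith [ha x]
  refine ⟨(a : 𝕜)⁻¹ • y, ?_, hyu, ?_⟩
  · rw [norm_smul, norm_inv, RCLike.norm_of_nonneg ha0.le]
    exact inv_mul_le_one_of_le₀ hy_le ha0.le
  · rwa [smul_inv_smul₀ (RCLike.ofReal_ne_zero.2 ha0.ne')]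

theorem QuasiReflexive.exists_eventually_norm_sub_sub_lt (hX : QuasiReflexive 𝕜 X) {ι : Type*}
    (W : Ultrafilter ι) {G : ι → StrongDual 𝕜 (StrongDual 𝕜 X)} {R : ℝ} (hG : ∀ i, ‖G i‖ ≤ R)
    {ε : ℝ} (hε : 0 < ε) :
    ∃ c, ∀ᶠ i in W, ∃ x : X, ‖G i - c - inclusionInDoubleDual 𝕜 X x‖ < ε := by
  let N := (inclusionInDoubleDual 𝕜 X).range.topologicalClosure
  have hN : IsClosed (N : Set (StrongDual 𝕜 (StrongDual 𝕜 X))) :=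
    Submodule.isClosed_topologicalClosure _
  have hfin : FiniteDimensional 𝕜 (StrongDual 𝕜 (StrongDual 𝕜 X) ⧸ N) :=
    haveI : FiniteDimensional 𝕜 (StrongDual 𝕜 (StrongDual 𝕜 X) ⧸
      (inclusionInDoubleDual 𝕜 X).range) := hX
    Module.Finite.of_surjective (Submodule.factor (Submodule.le_topologicalClosure _))
      (Submodule.factor_surjective _)
  have hproper : ProperSpace (StrongDual 𝕜 (StrongDual 𝕜 X) ⧸ N) := FiniteDimensional.proper 𝕜 _
  have hball : ∀ᶠ i in (W : Filter ι), N.mkQ (G i) ∈ Metric.closedBall 0 R :=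
    Eventually.of_forall fun i =>
      mem_closedBall_zero_iff.2 ((Submodule.Quotient.norm_mk_le _ _).trans (hG i))
  obtain ⟨q, -, hq⟩ := (isCompact_closedBall 0 R).ultrafilter_le_nhds
    (W.map fun i => N.mkQ (G i)) (le_principal_iff.2 hball)
  obtain ⟨c, rfl⟩ := N.mkQ_surjective q
  refine ⟨c, ?_⟩
  filter_upwards [hq (Metric.ball_mem_nhds _ (half_pos hε))] with i hi
  rw [Set.mem_preimage, mem_ball_iff_norm, ← map_sub] at hi
  obtain ⟨m, hm, hm_lt⟩ := QuotientAddGroup.norm_lt_iff.1 hi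
  have hmem : G i - c - m ∈ N := (Submodule.Quotient.eq N).1 hm.symm
  obtain ⟨_, ⟨x, rfl⟩, hx⟩ := Metric.mem_closure_iff.1 hmem (ε / 2) (half_pos hε)
  refine ⟨x, ?_⟩
  rw [dist_eq_norm, sub_right_comm] at hx
  have htri := norm_add_le (G i - c - inclusionInDoubleDual 𝕜 X x - m) m
  rw [sub_add_cancel] at htri
  exact htri.trans_lt ((add_lt_add hx hm_lt).trans_eq (add_halves ε))

theorem QuasiReflexive.eventually_exists_norm_pairDiff_sub_le (hX : QuasiReflexive 𝕜 X)
    {α : Type*} (U : Ultrafilter α) {G : List α → StrongDual 𝕜 (StrongDual 𝕜 X)} {R : ℝ}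
    (hG : ∀ σ, ‖G σ‖ ≤ R) {ε : ℝ} (hε : 0 < ε) (n j : ℕ) :
    ∀ᶠ τ in tensorPower (tensor U U) j,
      ∃ x : X, ‖pairDiff U G n τ - inclusionInDoubleDual 𝕜 X x‖ ≤ ε := by
  obtain ⟨c, hc⟩ := hX.exists_eventually_norm_sub_sub_lt (tensorPower U j)
    (norm_condLim_le (U := U) hG n) (half_pos hε)
  have hfst : ∀ᶠ τ : List (α × α) in tensorPower (tensor U U) j, ∃ x : X,
      ‖condLim U G n (τ.map Prod.fst) - c - inclusionInDoubleDual 𝕜 X x‖ < ε / 2 := by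
    have hmap := map_tensorPower Prod.fst (tensor U U) j
    rw [map_fst_tensor] at hmap
    rwa [← hmap] at hc
  have hsnd : ∀ᶠ τ : List (α × α) in tensorPower (tensor U U) j, ∃ x : X,
      ‖condLim U G n (τ.map Prod.snd) - c - inclusionInDoubleDual 𝕜 X x‖ < ε / 2 := by
    have hmap := map_tensorPower Prod.snd (tensor U U) j
    rw [map_snd_tensor] at hmap
    rwa [← hmap] at hc
  filter_upwards [hfst, hsnd] with τ ⟨x, hx⟩ ⟨y, hy⟩
  refine ⟨x - y, ?_⟩
  have htri := norm_sub_le (condLim U G n (τ.map Prod.fst) - c - inclusionInDoubleDual 𝕜 X x)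
    (condLim U G n (τ.map Prod.snd) - c - inclusionInDoubleDual 𝕜 X y)
  rw [sub_sub_sub_comm, sub_sub_sub_cancel_right, ← map_sub] at htri
  exact htri.trans ((add_lt_add hx hy).le.trans_eq (add_halves ε))

end Bidual

section Strategy

set_option maxSynthPendingDepth 3

theorem exists_run {S α : Type*} {k : ℕ} {I : ℕ → S → Prop} {r : ℕ → S → α → S → Prop} {s₀ : S}
    (h0 : I 0 s₀) (hstep : ∀ j < k, ∀ s, I j s → ∀ u, ∃ s', I (j + 1) s' ∧ r j s u s') :
    ∃ st : List α → S, st [] = s₀ ∧ (∀ t, t.length ≤ k → I t.length (st t)) ∧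
      ∀ t u, t.length < k → r t.length (st t) u (st (t ++ [u])) := by
  classical
  let next (j : ℕ) (s : S) (u : α) : S :=
    if h : ∃ s', I (j + 1) s' ∧ r j s u s' then h.choose else s
  have hnext {j : ℕ} (hj : j < k) {s : S} (hs : I j s) (u : α) :
      I (j + 1) (next j s u) ∧ r j s u (next j s u) := by
    have h := hstep j hj s hs u
    simpa only [next, dif_pos h] using h.choose_spec
  let st (t : List α) : S := List.reverseRecOn t s₀ fun t u s => next t.length s u
  have hnil : st [] = s₀ := List.reverseRecOn_nil ..
  have hst (t : List α) (u : α) : st (t ++ [u]) = next t.length (st t) u :=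
    List.reverseRecOn_concat ..
  have hI (t : List α) : t.length ≤ k → I t.length (st t) := by
    induction t using List.reverseRecOn with
    | nil => exact fun _ => hnil ▸ h0
    | append_singleton t u ih =>
      rw [List.length_append, List.length_singleton, hst]
      exact fun ht => (hnext ht (ih (Nat.le_of_succ_le ht)) u).1
  refine ⟨st, hnil, hI, fun t u ht => ?_⟩
  rw [hst]
  exact (hnext ht (hI t ht.le) u).2

theorem sum_take_smul_eq {R M α : Type*} [AddCommMonoid M] [SMul R M] {k : ℕ} {a : ℕ → R}
    {x v : List α → M} (h0 : v [] = 0)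
    (hv : ∀ t u, t.length < k → v (t ++ [u]) = v t + a t.length • x (t ++ [u])) (t : List α)
    (ht : t.length ≤ k) : ∑ i ∈ Finset.range t.length, a i • x (t.take (i + 1)) = v t := by
  induction t using List.reverseRecOn with
  | nil => exact h0.symm
  | append_singleton t u ih =>
    rw [List.length_append, List.length_singleton] at ht ⊢
    rw [Finset.sum_range_succ, List.take_of_length_le (by simp), hv t u ht,
      ← ih (Nat.le_of_succ_le ht)]
    congr 1
    refine Finset.sum_congr rfl fun i hi => ?_
    rw [List.take_append_of_le_length (Finset.mem_range.1 hi)]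

variable {𝕜 : Type*} [RCLike 𝕜] {X : Type*} [NormedAddCommGroup X] [NormedSpace 𝕜 X]
  {Y : Type*} [NormedAddCommGroup Y] [NormedSpace 𝕜 Y]

theorem tendsto_toWeakSpace_of_mem {x : WeakNhd 𝕜 X → X}
    (hx : ∀ u, toWeakSpace 𝕜 X (x u) ∈ OrderDual.ofDual u) :
    Tendsto (fun u => toWeakSpace 𝕜 X (x u)) atTop (𝓝 0) := by
  refine tendsto_nhds.2 fun V hV hV0 => ?_
  filter_upwards [eventually_ge_atTop (OrderDual.toDual ⟨⟨V, hV⟩, hV0⟩)] with u hu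
  exact hu (hx u)

/-- In the game where one player chooses weak neighbourhoods of `0` and the other answers with
vectors of the ball lying in them, a strategy of the latter is a weakly null tree. -/
theorem le_asymNorm_of_strategy (A : X →L[𝕜] Y) (a : ℕ →₀ 𝕜) {k : ℕ} {c : ℝ≥0∞}
    {I : ℕ → X → Prop} (h0 : I 0 0)
    (hstep : ∀ j < k, ∀ v, I j v → ∀ u : WeakNhd 𝕜 X, ∃ x : X, ‖x‖ ≤ 1 ∧
      toWeakSpace 𝕜 X x ∈ OrderDual.ofDual u ∧ I (j + 1) (v + a j • x))
    (hend : ∀ v, I k v → c ≤ ‖A v‖ₑ) : c ≤ asymNorm A a := by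
  obtain ⟨st, hst0, hI, hst⟩ := exists_run (S := X × X) (s₀ := 0) (k := k) (I := fun j s => I j s.1)
    (r := fun j s (u : WeakNhd 𝕜 X) s' => ‖s'.2‖ ≤ 1 ∧ toWeakSpace 𝕜 X s'.2 ∈ OrderDual.ofDual u ∧
      s'.1 = s.1 + a j • s'.2) h0 fun j hj s hs u => by
        obtain ⟨x, hx, hxu, hIx⟩ := hstep j hj s.1 hs u
        exact ⟨(s.1 + a j • x, x), hIx, hx, hxu, rfl⟩
  have htree : IsWeaklyNullTree 𝕜 k fun t => (st t).2 := by
    refine ⟨fun t ht htk => ?_, fun t ht => tendsto_toWeakSpace_of_mem fun u => (hst t u ht).2.1⟩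
    obtain ⟨t, u, rfl⟩ := (List.eq_nil_or_concat' t).resolve_left ht
    exact (hst t u (by simpa using htk)).1
  refine le_iSup_of_le k (le_iSup_of_le _ (le_iSup_of_le htree (le_iInf₂ fun t ht => ?_)))
  subst ht
  rw [sum_take_smul_eq (a := a) (x := fun t => (st t).2) (v := fun t => (st t).1)
    (congrArg Prod.fst hst0) (fun t u htk => (hst t u htk).2.2) t le_rfl]
  exact hend _ (hI t le_rfl)

theorem toC00_apply {n : ℕ} (a : Fin n → 𝕜) (i : Fin n) : toC00 a (i : ℕ) = a i := by
  rw [toC00, Finsupp.finsetSum_apply, Finset.sum_eq_single i, Finsupp.single_eq_same]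
  · exact fun j _ hj => Finsupp.single_eq_of_ne fun h => hj (Fin.ext h.symm)
  · simp

open NormedSpace (inclusionInDoubleDual)

theorem le_asymNorm_of_tendsto (A : X →L[𝕜] Y) {β : Type*} {l : Filter β} [l.NeBot]
    {T : Set (List β)} {d : List β → StrongDual 𝕜 (StrongDual 𝕜 X)} {k : ℕ} {a : Fin k → ℝ} {ε : ℝ}
    {c : ℝ≥0∞} (hε : 0 < ε) (hT0 : [] ∈ T) (hT : ∀ τ ∈ T, ∀ᶠ x in l, τ ++ [x] ∈ T) (hd0 : d [] = 0)
    (hlim : ∀ τ, τ.length < k → ∀ φ, Tendsto (fun x => d (τ ++ [x]) φ) l (𝓝 (d τ φ)))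
    (hstep : ∀ τ (i : Fin k), τ.length = (i : ℕ) → ∀ x, ‖d (τ ++ [x]) - d τ‖ + 2 * ε ≤ a i)
    (hnear : ∀ τ ∈ T, τ.length ≤ k → ∃ x, ‖d τ - inclusionInDoubleDual 𝕜 X x‖ ≤ ε / 2)
    (hend : ∀ τ ∈ T, τ.length = k → ∀ x, ‖inclusionInDoubleDual 𝕜 X x - d τ‖ ≤ k * (2 * ε) →
      c ≤ ‖A x‖ₑ) :
    c ≤ asymNorm A (toC00 fun i => (a i : 𝕜)) := by
  refine le_asymNorm_of_strategy A _ (k := k) (I := fun j v => ∃ τ ∈ T, τ.length = j ∧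
    ‖inclusionInDoubleDual 𝕜 X v - d τ‖ ≤ j * (2 * ε)) ⟨[], hT0, rfl, by simp [hd0]⟩ ?_
    fun v ⟨τ, hτT, hτ, hv⟩ => hend τ hτT hτ v hv
  rintro _ hτk v ⟨τ, hτT, rfl, hv⟩ u
  have hlim0 (φ : StrongDual 𝕜 X) : Tendsto (fun x => (d (τ ++ [x]) - d τ) φ) l (𝓝 0) := by
    simpa only [sub_apply, sub_self] using (hlim τ hτk φ).sub_const (d τ φ)
  have hnear_sub : ∀ᶠ x in l, ∃ y, ‖d (τ ++ [x]) - d τ - inclusionInDoubleDual 𝕜 X y‖ ≤ ε := by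
    obtain ⟨y₀, hy₀⟩ := hnear τ hτT hτk.le
    filter_upwards [hT τ hτT] with x hx
    obtain ⟨y, hy⟩ := hnear _ hx (by simpa using hτk)
    refine ⟨y - y₀, ?_⟩
    have htri := norm_sub_le (d (τ ++ [x]) - inclusionInDoubleDual 𝕜 X y)
      (d τ - inclusionInDoubleDual 𝕜 X y₀)
    rw [sub_sub_sub_comm, ← map_sub] at htri
    exact htri.trans ((add_le_add hy hy₀).trans_eq (add_halves ε))
  obtain ⟨x, hxT, y, hy, hyu, hyx⟩ := ((hT τ hτT).and (eventually_exists_norm_le_one_mem_weakNhd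
    hlim0 hε hnear_sub (hstep τ ⟨_, hτk⟩ rfl) u)).exists
  refine ⟨y, hy, hyu, τ ++ [x], hxT, by simp, ?_⟩
  have htri := norm_add_le (inclusionInDoubleDual 𝕜 X v - d τ)
    (inclusionInDoubleDual 𝕜 X ((a ⟨_, hτk⟩ : 𝕜) • y) - (d (τ ++ [x]) - d τ))
  rw [sub_add_sub_comm, add_sub_cancel, ← map_add] at htri
  rw [toC00_apply _ ⟨_, hτk⟩, Nat.cast_succ, add_one_mul]
  exact htri.trans (add_le_add hv hyx)

theorem ofReal_sub_le_enorm (A : X →L[𝕜] Y) {x v : X} {b δ : ℝ} (hb : b ≤ ‖A x‖)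
    (hv : ‖v - x‖ ≤ δ) : ENNReal.ofReal (b - ‖A‖ * δ) ≤ ‖A v‖ₑ := by
  rw [← ofReal_norm]
  refine ENNReal.ofReal_le_ofReal ?_
  have htri := norm_sub_norm_le (A x) (A v)
  rw [norm_sub_rev, ← map_sub] at htri
  linarith [A.le_of_opNorm_le_of_le le_rfl hv]

theorem QuasiReflexive.ofReal_sub_le_asymNorm (hX : QuasiReflexive 𝕜 X) (A : X →L[𝕜] Y)
    {α : Type*} {U : Ultrafilter α} {g : List α → X} {k : ℕ} {R b : ℝ} (hg : ∀ σ, ‖g σ‖ ≤ R)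
    {a D : Fin k → ℝ} (hD : ∀ σ (i : Fin k), σ.length = (i : ℕ) → ∀ x y ρ,
      ‖g (σ ++ x :: ρ) - g (σ ++ y :: ρ)‖ ≤ D i)
    {ε : ℝ} (hε : 0 < ε) (ha : ∀ i, 2 * D i + 2 * ε ≤ a i)
    (hb : ∀ᶠ τ : List (α × α) in tensorPower (tensor U U) k,
      b ≤ ‖A (g (τ.map Prod.fst) - g (τ.map Prod.snd))‖) :
    ENNReal.ofReal (b - ‖A‖ * (k * (2 * ε))) ≤ asymNorm A (toC00 fun i => (a i : 𝕜)) := by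
  let G (σ : List α) := inclusionInDoubleDual 𝕜 X (g σ)
  have hG (σ : List α) : ‖G σ‖ ≤ R := (norm_inclusionInDoubleDual _).trans_le (hg σ)
  let d (τ : List (α × α)) := pairDiff U G (k - τ.length) τ
  have hd {n : ℕ} {τ : List (α × α)} (hτ : k - τ.length = n) : d τ = pairDiff U G n τ := by
    rw [← hτ]
  have hsucc {n : ℕ} {τ : List (α × α)} (hτ : k = τ.length + n + 1) {x : α × α} :
      d (τ ++ [x]) = pairDiff U G n (τ ++ [x]) := by
    refine hd ?_
    rw [List.length_append, List.length_singleton]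
    lia
  obtain ⟨T, hT0, hT, hTR⟩ := exists_tree_of_eventually_tensorPower (U := tensor U U) (k := k)
    (R := fun τ => (∃ x, ‖d τ - inclusionInDoubleDual 𝕜 X x‖ ≤ ε / 2) ∧
      (τ.length = k → b ≤ ‖A (g (τ.map Prod.fst) - g (τ.map Prod.snd))‖)) fun n hn => by
    filter_upwards [hX.eventually_exists_norm_pairDiff_sub_le U hG (half_pos hε) (k - n) n,
      eventually_imp_distrib_left.2 fun h : n = k => h ▸ hb, eventually_length_eq _ n]
      with τ hnear hτb hτ
    subst hτ
    exact ⟨hnear, hτb⟩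
  refine le_asymNorm_of_tendsto A (l := tensor U U) (d := d) hε hT0 hT (pairDiff_nil _)
    (fun τ hτ φ => ?_) (fun τ i hτ x => ?_) (fun τ hτ hτk => (hTR τ hτ hτk).1)
    fun τ hτ hτk v hv => ?_
  · obtain ⟨n, hn⟩ := Nat.exists_eq_add_of_lt hτ
    simp only [hd (show k - τ.length = n + 1 by lia), hsucc hn]
    exact tendsto_pairDiff_append_singleton hG n τ φ
  · obtain ⟨n, hn⟩ := Nat.exists_eq_add_of_lt i.2
    rw [hd (show k - τ.length = n + 1 by lia), hsucc (hτ ▸ hn)]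
    have hGD (σ : List α) (hσ : σ.length = τ.length) (x y : α) (ρ : List α) :
        ‖G (σ ++ x :: ρ) - G (σ ++ y :: ρ)‖ ≤ D i := by
      rw [← map_sub, norm_inclusionInDoubleDual]
      exact hD σ i (hσ.trans hτ) x y ρ
    linarith [norm_pairDiff_append_singleton_sub_le (U := U) (n := n) hG hGD x, ha i]
  · rw [hd (show k - τ.length = 0 by lia), pairDiff_zero hG, ← map_sub, ← map_sub,
      norm_inclusionInDoubleDual] at hv
    exact ofReal_sub_le_enorm A ((hTR τ hτ hτk.le).2 hτk) hv

end Strategy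

section Concentration

set_option maxSynthPendingDepth 3

variable {k : ℕ} {w : Fin k → ℝ}

/-- The function `f` on `ℕ ^ k`, as a function of lists: a list is truncated, or padded by zeros, to
length `k`. -/
def onLists {α : Type*} (f : (Fin k → ℕ) → α) (σ : List ℕ) : α :=
  f fun i => σ.getD i 0

theorem onLists_ofFn {α : Type*} (f : (Fin k → ℕ) → α) (m : Fin k → ℕ) :
    onLists f (List.ofFn m) = f m := by
  simp [onLists]

section Lipschitz

variable {X : Type*} [NormedAddCommGroup X] {f : (Fin k → ℕ) → X} {C : ℝ}

theorem IsLipConst.norm_sub_le_of_forall_ne (hC : IsLipConst w f C) (hw : ∀ i, 0 ≤ w i)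
    {m n : Fin k → ℕ} {j : Fin k} (hmn : ∀ i ≠ j, m i = n i) : ‖f m - f n‖ ≤ C * w j := by
  refine (hC.2 m n).trans (mul_le_mul_of_nonneg_left ?_ hC.1)
  rw [graphDist, ← Finset.sum_singleton w j]
  refine Finset.sum_le_sum_of_subset_of_nonneg (fun i hi => ?_) fun i _ _ => hw i
  rw [Finset.mem_singleton]
  by_contra hij
  exact (Finset.mem_filter.1 hi).2 (hmn i hij)

theorem IsLipConst.norm_le (hC : IsLipConst w f C) (hw : ∀ i, 0 ≤ w i) (m : Fin k → ℕ) :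
    ‖f m‖ ≤ ‖f 0‖ + C * ∑ i, w i := by
  have hsub : ‖f m - f 0‖ ≤ C * ∑ i, w i :=
    (hC.2 m 0).trans (mul_le_mul_of_nonneg_left
      (Finset.sum_le_univ_sum_of_nonneg hw) hC.1)
  linarith [norm_sub_norm_le (f m) (f 0)]

theorem isLipConst_lip (hf : IsLipschitz w f) : IsLipConst w f (lip w f) := by
  have hclosed : IsClosed {C | IsLipConst w f C} := by
    simp only [IsLipConst, Set.ofPred_and, Set.ofPred_forall]
    exact isClosed_Ici.inter (isClosed_iInter fun m => isClosed_iInter fun n =>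
      isClosed_le continuous_const (continuous_id.mul continuous_const))
  exact hclosed.csInf_mem hf ⟨0, fun C hC => hC.1⟩

theorem IsLipConst.norm_onLists_sub_le (hC : IsLipConst w f C) (hw : ∀ i, 0 ≤ w i) {σ : List ℕ}
    {j : Fin k} (hσ : σ.length = (j : ℕ)) (x y : ℕ) (ρ : List ℕ) :
    ‖onLists f (σ ++ x :: ρ) - onLists f (σ ++ y :: ρ)‖ ≤ C * w j := by
  refine hC.norm_sub_le_of_forall_ne hw fun i hij => ?_
  rcases lt_or_gt_of_ne (Fin.val_ne_of_ne hij) with hlt | hgt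
  · rw [List.getD_append _ _ _ _ (hσ ▸ hlt), List.getD_append _ _ _ _ (hσ ▸ hlt)]
  · obtain ⟨l, hl⟩ := Nat.exists_eq_add_of_lt hgt
    rw [hl, ← hσ, List.getD_append_right _ _ _ _ (by lia), List.getD_append_right _ _ _ _ (by lia)]
    simp [Nat.add_assoc]

end Lipschitz

variable {𝕜 : Type*} [RCLike 𝕜] {X : Type*} [NormedAddCommGroup X] [NormedSpace 𝕜 X]
  {Y : Type*} [NormedAddCommGroup Y] [NormedSpace 𝕜 Y] {f : (Fin k → ℕ) → X} {C b : ℝ}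

theorem asymNorm_smul_le (A : X →L[𝕜] Y) {c : 𝕜} (hc : c ≠ 0) (a : ℕ →₀ 𝕜) :
    asymNorm A (c • a) ≤ ‖c‖ₑ * asymNorm A a := by
  refine iSup_le fun n => iSup₂_le fun x hx => ?_
  calc ⨅ (t : List (WeakNhd 𝕜 X)) (_ : t.length = n),
        ‖A (∑ i ∈ Finset.range n, (c • a) i • x (t.take (i + 1)))‖ₑ
      = ‖c‖ₑ * ⨅ (t : List (WeakNhd 𝕜 X)) (_ : t.length = n),
        ‖A (∑ i ∈ Finset.range n, a i • x (t.take (i + 1)))‖ₑ := by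
        simp only [ENNReal.mul_iInf_of_ne (enorm_ne_zero.2 hc) enorm_ne_top, ← enorm_smul,
          ← map_smul, Finset.smul_sum, Finsupp.smul_apply, smul_eq_mul, mul_smul]
    _ ≤ ‖c‖ₑ * asymNorm A a := by
        gcongr
        exact le_iSup_of_le n (le_iSup₂_of_le x hx le_rfl)

theorem toC00_const_mul {n : ℕ} (c : 𝕜) (a : Fin n → 𝕜) :
    toC00 (fun i => c * a i) = c • toC00 a := by
  simp [toC00, Finset.smul_sum]

theorem asymNorm_toC00_ofReal_mul_le (A : X →L[𝕜] Y) {r : ℝ} (hr : 0 < r) (a : Fin k → 𝕜) :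
    asymNorm A (toC00 fun i => (r : 𝕜) * a i) ≤ ENNReal.ofReal r * asymNorm A (toC00 a) := by
  have henorm : ‖(r : 𝕜)‖ₑ = ENNReal.ofReal r := by
    rw [← ofReal_norm, RCLike.norm_of_nonneg hr.le]
  rw [toC00_const_mul, ← henorm]
  exact asymNorm_smul_le A (RCLike.ofReal_ne_zero.2 hr.ne') _

theorem QuasiReflexive.ofReal_le_ofReal_mul_asymNorm (hX : QuasiReflexive 𝕜 X) (A : X →L[𝕜] Y)
    {U : Ultrafilter ℕ} (hw : ∀ i, 0 < w i) (hC : IsLipConst w f C)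
    (hA : asymNorm A (toC00 fun i => (w i : 𝕜)) ≠ ∞)
    (hb : ∀ᶠ τ : List (ℕ × ℕ) in tensorPower (tensor U U) k,
      b ≤ ‖A (onLists f (τ.map Prod.fst) - onLists f (τ.map Prod.snd))‖) :
    ENNReal.ofReal b ≤ ENNReal.ofReal (2 * C) * asymNorm A (toC00 fun i => (w i : 𝕜)) := by
  obtain ⟨δ, hδ, hδw⟩ := Pi.exists_forall_pos_add_lt (x := 0) hw
  have hlim (g : ℝ → ℝ) (hg : Continuous g) :
      Tendsto (fun s => ENNReal.ofReal (g s)) (𝓝[>] 0) (𝓝 (ENNReal.ofReal (g 0))) :=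
    ((ENNReal.continuous_ofReal.comp hg).tendsto 0).mono_left nhdsWithin_le_nhds
  have hleft := hlim (fun s => b - ‖A‖ * (k * (2 * (s * (δ / 2))))) (by fun_prop)
  have hright := ENNReal.Tendsto.mul_const (hlim (fun s => 2 * C + s) (by fun_prop)) (.inr hA)
  simp only [zero_mul, mul_zero, sub_zero, add_zero] at hleft hright
  refine le_of_tendsto_of_tendsto hleft hright ?_
  filter_upwards [self_mem_nhdsWithin] with s (hs : 0 < s)
  refine le_trans ?_ (asymNorm_toC00_ofReal_mul_le A (r := 2 * C + s) (by linarith [hC.1]) _)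
  simp only [← RCLike.ofReal_mul]
  refine hX.ofReal_sub_le_asymNorm A (g := onLists f) (fun σ => hC.norm_le (fun i => (hw i).le) _)
    (fun σ i hσ => hC.norm_onLists_sub_le (fun i => (hw i).le) hσ) (by positivity) (fun i => ?_) hb
  have hδ_le : δ ≤ w i := by simpa using (hδw i).le
  linarith [mul_le_mul_of_nonneg_left hδ_le hs.le]

/-- The graph `G_k` concentrates under `g`: on some infinite set of indices, the values of `g` at
interlaced pairs are within `B` of each other. -/
def IsConcentrated (g : (Fin k → ℕ) → Y) (B : ℝ) : Prop :=
  ∃ M : Set ℕ, M.Infinite ∧ ∀ m n : Fin k → ℕ, (∀ i, m i ∈ M) → (∀ i, n i ∈ M) →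
    Interlaced m n → ‖g m - g n‖ ≤ B

theorem isConcentrated_of_forall_eq {g : (Fin k → ℕ) → Y} {B : ℝ} (hB : 0 ≤ B)
    (hg : ∀ m n, g m = g n) : IsConcentrated g B :=
  ⟨Set.univ, Set.infinite_univ, fun m n _ _ _ => by rwa [hg m n, sub_self, norm_zero]⟩

theorem QuasiReflexive.isConcentrated (hX : QuasiReflexive 𝕜 X) (A : X →L[𝕜] Y)
    (hw : ∀ i, 0 < w i) (hC : IsLipConst w f C) {ϑ : ℝ}
    (hϑ : 2 * asymNorm A (toC00 fun i => (w i : 𝕜)) < ENNReal.ofReal ϑ) :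
    IsConcentrated (fun m => A (f m)) (C * ϑ) := by
  have hA : asymNorm A (toC00 fun i => (w i : 𝕜)) ≠ ∞ := fun h => by simp [h] at hϑ
  rcases hC.1.eq_or_lt with rfl | hC0
  · refine isConcentrated_of_forall_eq (zero_mul ϑ).ge fun m n => congrArg A ?_
    simpa [sub_eq_zero] using hC.2 m n
  have hlt : ¬ENNReal.ofReal (C * ϑ) ≤
      ENNReal.ofReal (2 * C) * asymNorm A (toC00 fun i => (w i : 𝕜)) := by
    rw [not_le, mul_comm 2, ENNReal.ofReal_mul hC0.le, ENNReal.ofReal_mul hC0.le, mul_assoc,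
      ENNReal.ofReal_ofNat]
    exact ENNReal.mul_lt_mul_right (by simpa using hC0) ENNReal.ofReal_ne_top hϑ
  have hU : ∀ᶠ τ : List (ℕ × ℕ) in tensorPower (tensor (hyperfilter ℕ) (hyperfilter ℕ)) k,
      ¬C * ϑ ≤ ‖A (onLists f (τ.map Prod.fst) - onLists f (τ.map Prod.snd))‖ :=
    Ultrafilter.eventually_not.2 (mt (hX.ofReal_le_ofReal_mul_asymNorm A hw hC hA) hlt)
  obtain ⟨M, hM, h⟩ := exists_infinite_forall_interlaced Nat.hyperfilter_le_atTop hU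
  refine ⟨M, hM, fun m n hm hn hmn => ?_⟩
  have hmn' := h m n hm hn hmn
  simp only [List.map_ofFn, Function.comp_def, onLists_ofFn, not_le, map_sub] at hmn'
  exact hmn'.le

theorem QuasiReflexive.isConcentrated_of_asymNorm_le (hX : QuasiReflexive 𝕜 X) (A : X →L[𝕜] Y)
    (hw : ∀ i, 0 < w i) (hC : IsLipConst w f C) {B ϑ : ℝ} (hB : 0 < B)
    (hA : asymNorm A (toC00 fun i => (w i : 𝕜)) ≤ ENNReal.ofReal B) (hϑ : 2 < ϑ) :
    IsConcentrated (fun m => A (f m)) (C * (ϑ * B)) := by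
  refine hX.isConcentrated A hw hC ((mul_le_mul_right hA 2).trans_lt ?_)
  rw [← ENNReal.ofReal_ofNat, ← ENNReal.ofReal_mul zero_le_two]
  exact (ENNReal.ofReal_lt_ofReal_iff (by positivity)).2 (mul_lt_mul_of_pos_right hϑ hB)

theorem norm_toLp_eq_mul {ι E F : Type*} [Fintype ι] [NormedAddCommGroup E]
    [NormedAddCommGroup F] {p : ℝ≥0∞} (hp : 0 < p) {c : ℝ} (hc : 0 ≤ c) {u : ι → E} {v : ι → F}
    (h : ∀ i, ‖v i‖ = c * ‖u i‖) :
    ‖(WithLp.toLp p v : PiLp p fun _ : ι => F)‖ =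
      c * ‖(WithLp.toLp p u : PiLp p fun _ : ι => E)‖ := by
  rcases eq_or_ne p ∞ with rfl | hp'
  · simp only [PiLp.norm_eq_ciSup, h, Real.mul_iSup_of_nonneg hc]
  · have hp0 : 0 < p.toReal := ENNReal.toReal_pos hp.ne' hp'
    simp only [PiLp.norm_eq_sum hp0, h, Real.mul_rpow hc (norm_nonneg _), ← Finset.mul_sum]
    rw [Real.mul_rpow (by positivity) (by positivity), one_div,
      Real.rpow_rpow_inv hc hp0.ne']

theorem norm_toLp_pos {ι E : Type*} [Fintype ι] [NormedAddCommGroup E] {p : ℝ≥0∞} (hp : 0 < p)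
    {v : ι → E} {j : ι} (hj : v j ≠ 0) : 0 < ‖(WithLp.toLp p v : PiLp p fun _ : ι => E)‖ := by
  have hpos : 0 < ‖v j‖ := norm_pos_iff.2 hj
  rcases eq_or_ne p ∞ with rfl | hp'
  · rw [PiLp.norm_eq_ciSup]
    exact hpos.trans_le (le_ciSup (f := fun i => ‖v i‖) (Set.finite_range _).bddAbove j)
  · rw [PiLp.norm_eq_sum (ENNReal.toReal_pos hp.ne' hp')]
    exact Real.rpow_pos_of_pos (Finset.sum_pos' (fun i _ => by positivity)
      ⟨j, Finset.mem_univ j, Real.rpow_pos_of_pos hpos _⟩) _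

theorem asymNorm_toC00_le_ofReal_mul_alpha {p : ℝ≥0∞} (hp : 0 < p) (A : X →L[𝕜] Y)
    (hw : 0 < ‖(WithLp.toLp p w : PiLp p fun _ : Fin k => ℝ)‖) :
    asymNorm A (toC00 fun i => (w i : 𝕜)) ≤
      ENNReal.ofReal ‖(WithLp.toLp p w : PiLp p fun _ : Fin k => ℝ)‖ * alpha p A := by
  set r := ‖(WithLp.toLp p w : PiLp p fun _ : Fin k => ℝ)‖
  let a (i : Fin k) : 𝕜 := ((r⁻¹ * w i : ℝ) : 𝕜)
  have ha : ‖(WithLp.toLp p a : PiLp p fun _ : Fin k => 𝕜)‖ ≤ 1 := by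
    rw [norm_toLp_eq_mul hp (inv_nonneg.2 hw.le) (u := w), inv_mul_cancel₀ hw.ne']
    intro i
    rw [RCLike.norm_ofReal, abs_mul, abs_of_pos (inv_pos.2 hw), Real.norm_eq_abs]
  calc asymNorm A (toC00 fun i => (w i : 𝕜)) = asymNorm A (toC00 fun i => (r : 𝕜) * a i) := by
        simp only [a, ← RCLike.ofReal_mul, mul_inv_cancel_left₀ hw.ne']
    _ ≤ ENNReal.ofReal r * asymNorm A (toC00 a) := asymNorm_toC00_ofReal_mul_le A hw a
    _ ≤ ENNReal.ofReal r * alpha p A := by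
        gcongr
        exact le_iSup_of_le k (le_iSup₂_of_le (WithLp.toLp p a) ha le_rfl)

theorem asymNorm_toC00_one_le_mul_bigN (p : ℝ≥0∞) (A : X →L[𝕜] Y) (hk : 1 ≤ k) :
    asymNorm A (toC00 fun _ : Fin k => (1 : 𝕜)) ≤
      ENNReal.ofReal ((k : ℝ) ^ (p⁻¹).toReal) * bigN p A := by
  have hk𝕜 : (k : 𝕜) ≠ 0 := Nat.cast_ne_zero.2 (by lia)
  have hkℝ : (0 : ℝ) < k := Nat.cast_pos.2 hk
  calc asymNorm A (toC00 fun _ : Fin k => (1 : 𝕜))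
      = asymNorm A (toC00 fun _ : Fin k => ((k : ℝ) : 𝕜) * (k : 𝕜)⁻¹) := by
        rw [RCLike.ofReal_natCast, mul_inv_cancel₀ hk𝕜]
    _ ≤ ENNReal.ofReal k * theta k A := asymNorm_toC00_ofReal_mul_le A hkℝ _
    _ = ENNReal.ofReal ((k : ℝ) ^ (p⁻¹).toReal) *
        ((k : ℝ≥0∞) ^ (1 - (p⁻¹).toReal) * theta k A) := by
        rw [← mul_assoc, ← ENNReal.ofReal_natCast k, ENNReal.ofReal_rpow_of_pos hkℝ,
          ← ENNReal.ofReal_mul (by positivity), ← Real.rpow_add hkℝ, add_sub_cancel, Real.rpow_one]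
    _ ≤ ENNReal.ofReal ((k : ℝ) ^ (p⁻¹).toReal) * bigN p A := by
        gcongr
        exact le_iSup₂_of_le k hk le_rfl

theorem QuasiReflexive.isConcentrated_of_classA (hX : QuasiReflexive 𝕜 X) {A : X →L[𝕜] Y}
    {p : ℝ≥0∞} (hp : 0 < p) (hA : ClassA p A) (hα : 0 < alpha p A) (hw : ∀ i, 0 < w i)
    (hC : IsLipConst w f C) {ϑ : ℝ} (hϑ : 2 < ϑ) :
    IsConcentrated (fun m => A (f m)) (ϑ * C * (alpha p A).toReal *
      ‖(WithLp.toLp p w : PiLp p fun _ : Fin k => ℝ)‖) := by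
  rcases k.eq_zero_or_pos with rfl | hk
  · have hnorm : ‖(WithLp.toLp p w : PiLp p fun _ : Fin 0 => ℝ)‖ = 0 := by
      simpa using norm_toLp_eq_mul hp le_rfl (u := w) (v := w) finZeroElim
    exact isConcentrated_of_forall_eq (by simp [hnorm]) fun m n => by rw [Subsingleton.elim m n]
  have hnorm := norm_toLp_pos hp (hw ⟨0, hk⟩).ne'
  have hle := asymNorm_toC00_le_ofReal_mul_alpha (𝕜 := 𝕜) hp A hnorm
  rw [← ENNReal.ofReal_toReal hA.ne, ← ENNReal.ofReal_mul hnorm.le] at hle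
  convert hX.isConcentrated_of_asymNorm_le A hw hC
    (mul_pos hnorm (ENNReal.toReal_pos hα.ne' hA.ne)) hle hϑ using 1
  ring

theorem QuasiReflexive.isConcentrated_of_classN (hX : QuasiReflexive 𝕜 X) {A : X →L[𝕜] Y}
    {p : ℝ≥0∞} (hA : ClassN p A) (hN : 0 < bigN p A) (hC : IsLipConst (fun _ => 1) f C) {ϑ : ℝ}
    (hϑ : 2 < ϑ) :
    IsConcentrated (fun m => A (f m))
      (ϑ * C * (bigN p A).toReal * (k : ℝ) ^ (p⁻¹).toReal) := by
  rcases k.eq_zero_or_pos with rfl | hk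
  · have hC0 := hC.1
    exact isConcentrated_of_forall_eq (by positivity) fun m n => by rw [Subsingleton.elim m n]
  have hpow : 0 < (k : ℝ) ^ (p⁻¹).toReal := by positivity
  have hle := asymNorm_toC00_one_le_mul_bigN p A hk
  rw [← ENNReal.ofReal_toReal hA.ne, ← ENNReal.ofReal_mul hpow.le] at hle
  convert hX.isConcentrated_of_asymNorm_le A (fun _ => one_pos) hC
    (mul_pos hpow (ENNReal.toReal_pos hN.ne' hA.ne)) (by simpa using hle) hϑ using 1
  ring

end Concentration

end AsymptoticSmoothness

end

open AsymptoticSmoothness in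
theorem mainTheorem6_general {𝕜 : Type*} [RCLike 𝕜]
    {X : Type*} [NormedAddCommGroup X] [NormedSpace 𝕜 X]
    {Y : Type*} [NormedAddCommGroup Y] [NormedSpace 𝕜 Y]
    (p : ℝ≥0∞) (hp : 0 < p) (hX : QuasiReflexive 𝕜 X) (A : X →L[𝕜] Y) :
    (∀ (k : ℕ) (w : Fin k → ℝ), (∀ i, 0 < w i) →
      ∀ ϑ : ℝ, 2 * asymNorm A (toC00 fun i => (w i : 𝕜)) < ENNReal.ofReal ϑ →
      ∀ f : (Fin k → ℕ) → X, IsLipschitz w f →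
      IsConcentrated (fun m => A (f m)) (lip w f * ϑ)) ∧
    (ClassA p A → 0 < alpha p A → ∀ ϑ : ℝ, 2 < ϑ →
      ∀ (k : ℕ) (w : Fin k → ℝ), (∀ i, 0 < w i) → ∀ f : (Fin k → ℕ) → X, IsLipschitz w f →
      IsConcentrated (fun m => A (f m)) (ϑ * lip w f * (alpha p A).toReal *
        ‖(WithLp.toLp p w : PiLp p fun _ : Fin k => ℝ)‖)) ∧
    (ClassN p A → 0 < bigN p A → ∀ ϑ : ℝ, 2 < ϑ →
      ∀ (k : ℕ) (f : (Fin k → ℕ) → X), IsLipschitz (fun _ => 1) f →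
      IsConcentrated (fun m => A (f m))
        (ϑ * lip (fun _ => 1) f * (bigN p A).toReal * (k : ℝ) ^ (p⁻¹).toReal)) :=
  ⟨fun _ _ hw _ hϑ _ hf => hX.isConcentrated A hw (isLipConst_lip hf) hϑ,
    fun hA hα _ hϑ _ _ hw _ hf => hX.isConcentrated_of_classA hp hA hα hw (isLipConst_lip hf) hϑ,
    fun hA hN _ hϑ _ _ hf => hX.isConcentrated_of_classN hA hN (isLipConst_lip hf) hϑ⟩

theorem mainTheorem6 {𝕜 : Type*} [RCLike 𝕜]
    {X : Type*} [NormedAddCommGroup X] [NormedSpace 𝕜 X] [CompleteSpace X]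
    {Y : Type*} [NormedAddCommGroup Y] [NormedSpace 𝕜 Y] [CompleteSpace Y]
    (p : ℝ≥0∞) (hp : 1 < p) (hX : AsymptoticSmoothness.QuasiReflexive 𝕜 X) (A : X →L[𝕜] Y) :
    (∀ (k : ℕ) (w : Fin k → ℝ), (∀ i, 0 < w i) →
      ∀ ϑ : ℝ, 2 * AsymptoticSmoothness.asymNorm A
          (AsymptoticSmoothness.toC00 (fun i => (w i : 𝕜))) < ENNReal.ofReal ϑ →
      ∀ f : (Fin k → ℕ) → X, AsymptoticSmoothness.IsLipschitz w f →
      ∃ M : Set ℕ, M.Infinite ∧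
        ∀ m n : Fin k → ℕ, (∀ i, m i ∈ M) → (∀ i, n i ∈ M) →
          AsymptoticSmoothness.Interlaced m n →
          ‖A (f m) - A (f n)‖ ≤ AsymptoticSmoothness.lip w f * ϑ) ∧
    (AsymptoticSmoothness.ClassA p A → 0 < AsymptoticSmoothness.alpha p A →
      ∀ ϑ : ℝ, 2 < ϑ → ∀ (k : ℕ) (w : Fin k → ℝ), (∀ i, 0 < w i) →
      ∀ f : (Fin k → ℕ) → X, AsymptoticSmoothness.IsLipschitz w f →
      ∃ M : Set ℕ, M.Infinite ∧
        ∀ m n : Fin k → ℕ, (∀ i, m i ∈ M) → (∀ i, n i ∈ M) →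
          AsymptoticSmoothness.Interlaced m n →
          ‖A (f m) - A (f n)‖ ≤ ϑ * AsymptoticSmoothness.lip w f *
            (AsymptoticSmoothness.alpha p A).toReal *
            ‖(WithLp.toLp p w : PiLp p (fun _ : Fin k => ℝ))‖) ∧
    (AsymptoticSmoothness.ClassN p A → 0 < AsymptoticSmoothness.bigN p A →
      ∀ ϑ : ℝ, 2 < ϑ → ∀ (k : ℕ) (f : (Fin k → ℕ) → X),
      AsymptoticSmoothness.IsLipschitz (fun _ => 1) f →
      ∃ M : Set ℕ, M.Infinite ∧
        ∀ m n : Fin k → ℕ, (∀ i, m i ∈ M) → (∀ i, n i ∈ M) →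
          AsymptoticSmoothness.Interlaced m n →
          ‖A (f m) - A (f n)‖ ≤ ϑ * AsymptoticSmoothness.lip (fun _ => 1) f *
            (AsymptoticSmoothness.bigN p A).toReal * (k : ℝ) ^ (p⁻¹).toReal) :=
  mainTheorem6_general p (zero_lt_one.trans hp) hX A
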